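/- Theorem 5.1. Let $k$ be a non-negative integer, and let $\,{}_1F_1(a;c;x)=\sum_{n\ge0}\frac{(a)_n}{(c)_n}\frac{x^n}{n!}$ and ${}_2F_1(a,b;c;x)=\sum_{n\ge 0}\frac{(a)_n(b)_n}{(c)_n}\frac{x^n}{n!}$ (finite sums when $a$ is a non-positive integer). For $\alpha>0$ and $n\in\{2k,2k+1\}$ put $$L_n(\alpha)=\alpha^{-1/4}\,{}_2F_1\!\left(-n,1;\tfrac32;2\right)-4\alpha^{3/4}\int_{-\infty}^0\frac{xe^{-\alpha x^2}}{e^{2\pi x}-1}\,{}_1F_1\!\left(-n;\tfrac32;2\alpha x^2\right)dx ,$$ the integrals being absolutely convergent. Let $\alpha,\beta>0$ with $\alpha\beta=\pi^2$. Then: (i) $L_{2k}(\alpha)=L_{2k}(\beta)$. (ii) Put $C={}_2F_1(-2k,1;\tfrac32;2)$. Then $C>0$, and $L_{2k}(\alpha)$ is "nearly" equal to $$R(\alpha,\beta)=-C\left(\frac1\alpha+\frac1\beta+\frac{2}{3C}\right)^{1/4},$$ in the sense that the first two terms of their asymptotic expansions agree, both when $\alpha$ is very small and when $\alpha$ is very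 large: as $\alpha\to0^+$ (with $\beta=\pi^2/\alpha$), both $L_{2k}(\alpha)$ and $R(\alpha,\beta)$ are equal to $$-C\alpha^{-1/4}-\tfrac16\alpha^{3/4}+O_k(\alpha^{7/4}),$$ and as $\beta\to0^+$ (with $\alpha=\pi^2/\beta\to\infty$), both are equal to $-C\beta^{-1/4}-\tfrac16\beta^{3/4}+O_k(\beta^{7/4})$. (iii) $-L_{2k+1}(\alpha)=L_{2k+1}(\beta)$. In particular, for $\alpha=\beta=\pi$, $$\int_{-\infty}^0\frac{xe^{-\pi x^2}}{e^{2\pi x}-1}\,{}_1F_1\!\left(-2k-1;\tfrac32;2\pi x^2\right)dx=\frac1{4\pi}\,{}_2F_1\!\left(-2k-1,1;\tfrac32;2\right).$$ -/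

import Mathlib

open Real Set Filter Topology MeasureTheory Asymptotics

noncomputable section

/-- Kummer's confluent hypergeometric function `₁F₁(a; c; x) = ∑ (a)_n / (c)_n * x^n / n!`
(real parameters and argument). -/
def kummerF (a c x : ℝ) : ℝ :=
  ∑' n : ℕ, (ascPochhammer ℝ n).eval a / (ascPochhammer ℝ n).eval c * x ^ n / (n.factorial : ℝ)

/-- The integrand `x e^{-αx²} / (e^{2πx} - 1) * ₁F₁(a; 3/2; 2αx²)`. -/
def hypIntegrand (a α x : ℝ) : ℝ :=
  x * exp (-α * x ^ 2) / (exp (2 * π * x) - 1) * kummerF a (3 / 2) (2 * α * x ^ 2)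

/-- The constant `₂F₁(a, 1; 3/2; 2)`; for `a` a non-positive integer, the only case used, the
hypergeometric series is a finite sum. -/
def hypConst (a : ℝ) : ℝ := ₂F₁ a 1 (3 / 2) (2 : ℝ)

/-- `α^{-1/4} ₂F₁(a, 1; 3/2; 2) - 4 α^{3/4} ∫_{-∞}^0 x e^{-αx²} / (e^{2πx} - 1) ₁F₁(a; 3/2; 2αx²) dx`. -/
def hypSide (a α : ℝ) : ℝ :=
  α ^ (-1 / 4 : ℝ) * hypConst a
    - 4 * α ^ (3 / 4 : ℝ) * ∫ x in Iic (0 : ℝ), hypIntegrand a α x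

/-- The approximating function `- C (1/α + 1/β + 2/(3C))^{1/4}` with `C = ₂F₁(a, 1; 3/2; 2)`. -/
def hypApprox (a α β : ℝ) : ℝ :=
  -hypConst a * (1 / α + 1 / β + 2 / (3 * hypConst a)) ^ (1 / 4 : ℝ)

/-- As `t → 0+`, the asymptotic expansion of `f` in the scale `t^{-1/4}, t^{3/4}, t^{7/4}, …`
begins with `c₀ t^{-1/4} + c₁ t^{3/4}`. -/
def HasTwoTermExpansion (f : ℝ → ℝ) (c₀ c₁ : ℝ) : Prop :=
  (fun t : ℝ => f t - (c₀ * t ^ (-1 / 4 : ℝ) + c₁ * t ^ (3 / 4 : ℝ)))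
    =O[𝓝[>] 0] fun t : ℝ => t ^ (7 / 4 : ℝ)

end

/-!
For `n : ℕ` put `P_n(y) = ₁F₁(-n; 3/2; 2y)`, a polynomial (`kummerPoly`). The reflection `x ↦ -x`
turns the integral in `hypSide (-n) α` into one over `(0, ∞)` with kernel
`x / (1 - e^{-2πx}) = (x + x coth (πx)) / 2`. The summand `x` contributes
`₂F₁(-n, 1; 3/2; 2) / (4α)`, which cancels the constant term, so that (`hypSide_eq`)
`hypSide (-n) α = -2 T_n(α)`, where
`T_n(α) = α^{3/4} ∫₀^∞ x coth (πx) e^{-αx²} P_n(αx²) dx` (`cothMoment`).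

*Symmetry.* For `n = 0`, the partial fractions of the cotangent give
`πx coth (πx) = ∑_{m ∈ ℤ} x² / (x² + m²) = ∫₀^∞ x² e^{-tx²} θ(t) dt` with
`θ(t) = ∑_{m ∈ ℤ} e^{-m²t}`; by Tonelli `T_0(α)` is a multiple of
`α^{3/4} ∫₀^∞ θ(t) (t + α)^{-3/2} dt`, and the substitution `t ↦ π²/t` together with
`θ(t) = √(π/t) θ(π²/t)` gives `T_0(π²/α) = T_0(α)` (`cothMoment_zero_symm`). For larger `n` no
further analysis is needed: the derivation `α d/dα` acts on the functions `α^{3/4} e^{-αx²} p(αx²)` through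
an operator `E` on polynomials (`eulerOp`), the `P_n` satisfy
`(n + 3/2) P_{n+1} = n P_{n-1} + 2 E P_n` (`kummerPoly_rec`), and `α d/dα` changes sign under
`α ↦ π²/α`. Hence `T_n(π²/α) = (-1)^n T_n(α)` by induction (`cothMoment_symm`).

*Sign of the constant.* `₂F₁(-n, 1; 3/2; 2) = ∫₀^∞ e^{-y} P_n(y) dy`, and integrating the three-term
relation gives `(n + 3/2) C_{n+1} = n C_{n-1} - C_n / 2`, whence `(-1)^n C_n > 0`
(`expMoment_kummerPoly_sign`).

*Asymptotics.* Writing `x coth (πx) = x + 2x / (e^{2πx} - 1)`, the first summand yields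
`-C α^{-1/4}` exactly, and in the second `e^{-y} P_n(y) = 1 + O(y)` together with
`∫₀^∞ x / (e^{2πx} - 1) dx = 1/24` yields `-α^{3/4}/6 + O(α^{7/4})` (`hypSide_expansion`). The
expansion at infinity follows by the symmetry, and that of the approximating function from
`(1 + u)^{1/4} = 1 + u/4 + O(u²)`.
-/

noncomputable section

/-! ### The Kummer polynomials and their three-term relation -/

/-- The polynomial `y ↦ ₁F₁(-n; 3/2; 2y)`. -/
def kummerPoly (n : ℕ) : Polynomial ℝ :=
  ∑ j ∈ Finset.range (n + 1), Polynomial.C ((ascPochhammer ℝ j).eval (-n : ℝ) * 2 ^ j /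
    ((ascPochhammer ℝ j).eval (3 / 2 : ℝ) * (j.factorial : ℝ))) * Polynomial.X ^ j

/-- The operator `E p = (3/4) p + X p' - X p` on polynomials, for which
`α d/dα (α^{3/4} e^{-αx²} p(αx²)) = α^{3/4} e^{-αx²} (E p)(αx²)`. -/
def eulerOp (p : Polynomial ℝ) : Polynomial ℝ :=
  Polynomial.C (3 / 4) * p + (Polynomial.X * Polynomial.derivative p - Polynomial.X * p)

/-- The functional `p ↦ ∫₀^∞ e^{-y} p(y) dy`, given by its values `j!` on the monomials. -/
def expMoment : Polynomial ℝ →ₗ[ℝ] ℝ :=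
  Polynomial.lsum fun j => (j.factorial : ℝ) • LinearMap.id

lemma ascPochhammer_eval_neg_nat {n j : ℕ} (h : n < j) :
    (ascPochhammer ℝ j).eval (-n : ℝ) = 0 :=
  (ascPochhammer_eval_eq_zero_iff j _).2 ⟨n, h, by simp⟩

/-- The formula holds for every `j`: for `j > n` the Pochhammer symbol `(-n)_j` vanishes. -/
lemma kummerPoly_coeff (n j : ℕ) :
    (kummerPoly n).coeff j = (ascPochhammer ℝ j).eval (-n : ℝ) * 2 ^ j /
      ((ascPochhammer ℝ j).eval (3 / 2 : ℝ) * (j.factorial : ℝ)) := by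
  simp only [kummerPoly, Polynomial.finsetSum_coeff, Polynomial.coeff_C_mul_X_pow]
  rw [Finset.sum_ite_eq]
  split_ifs with h
  · rfl
  · rw [ascPochhammer_eval_neg_nat (by simpa using h)]
    simp

lemma kummerF_neg_nat (n : ℕ) (y : ℝ) :
    kummerF (-n) (3 / 2) (2 * y) = (kummerPoly n).eval y := by
  rw [kummerF, tsum_eq_sum (s := Finset.range (n + 1)), kummerPoly, Polynomial.eval_finsetSum]
  · refine Finset.sum_congr rfl fun j _ => ?_
    simp only [Polynomial.eval_mul, Polynomial.eval_C, Polynomial.eval_pow, Polynomial.eval_X]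
    rw [mul_pow]
    field_simp
  · intro j hj
    rw [ascPochhammer_eval_neg_nat (by simpa using hj)]
    simp

lemma hypConst_neg_nat (n : ℕ) : hypConst (-n) = expMoment (kummerPoly n) := by
  rw [hypConst, ordinaryHypergeometric_eq_tsum]
  beta_reduce
  rw [tsum_eq_sum (s := Finset.range (n + 1)), kummerPoly, map_sum]
  · refine Finset.sum_congr rfl fun j _ => ?_
    have hj : (j.factorial : ℝ) ≠ 0 := by positivity
    rw [Polynomial.C_mul_X_pow_eq_monomial, expMoment, Polynomial.lsum_apply,
      Polynomial.sum_monomial_index _ _ (by simp), ascPochhammer_eval_one]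
    simp only [smul_eq_mul, LinearMap.smul_apply, LinearMap.id_apply]
    field_simp
  · intro j hj
    rw [ascPochhammer_eval_neg_nat (by simpa using hj)]
    simp

/-- Integration by parts, `∫₀^∞ e^{-y} (y p'(y) - y p(y)) dy = -∫₀^∞ e^{-y} p(y) dy`, checked on
monomials. -/
lemma expMoment_eulerOp (p : Polynomial ℝ) : expMoment (eulerOp p) = -1 / 4 * expMoment p := by
  induction p using Polynomial.induction_on' with
  | add p q hp hq =>
    have : eulerOp (p + q) = eulerOp p + eulerOp q := by
      simp only [eulerOp, Polynomial.derivative_add]; ring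
    rw [this, map_add, map_add, hp, hq]; ring
  | monomial j a =>
    have key : ∀ (i : ℕ) (b : ℝ), expMoment (Polynomial.monomial i b) = i.factorial * b := by
      intro i b
      rw [expMoment, Polynomial.lsum_apply, Polynomial.sum_monomial_index _ _ (by simp)]
      simp
    have : eulerOp (Polynomial.monomial j a) =
        Polynomial.monomial j ((3 / 4 + j) * a) - Polynomial.monomial (j + 1) a := by
      rw [eulerOp, Polynomial.C_mul_monomial, Polynomial.derivative_monomial,
        Polynomial.X_mul_monomial, Polynomial.X_mul_monomial, add_mul, map_add]
      rcases j with _ | j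
      · simp [sub_eq_add_neg]
      · simp [mul_comm]; ring
    rw [this, map_sub, key, key, key, Nat.factorial_succ]
    push_cast
    ring

/-- The three-term relation `(n + 3/2) P_{n+1} = n P_{n-1} + 2 E P_n` of the polynomials
`P_n(y) = ₁F₁(-n; 3/2; 2y)`, with `n` shifted by one. The generating function
`∑ (3/2)_n / n! P_n(y) z^n = (1 - z)^{-3/2} e^{-2yz/(1 - z)}` explains it: times `e^{-αx²}` at
`y = αx²`, it is a Gaussian with parameter `α (1 + z) / (1 - z)`. The proof compares coefficients. -/
lemma kummerPoly_rec (n : ℕ) :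
    Polynomial.C (n + 1 + 3 / 2 : ℝ) * kummerPoly (n + 2) =
      Polynomial.C (n + 1 : ℝ) * kummerPoly n + Polynomial.C 2 * eulerOp (kummerPoly (n + 1)) := by
  have hp : ∀ (j : ℕ) (x : ℝ), (ascPochhammer ℝ (j + 1)).eval x =
      x * (ascPochhammer ℝ j).eval (x + 1) := by
    intro j x; simp [ascPochhammer_succ_left, Polynomial.eval_comp]
  have hs : ∀ (j : ℕ) (x : ℝ), (ascPochhammer ℝ (j + 1)).eval x =
      (ascPochhammer ℝ j).eval x * (x + j) := by
    intro j x; rw [ascPochhammer_succ_eval]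
  ext j
  simp only [eulerOp, Polynomial.coeff_add, Polynomial.coeff_C_mul, Polynomial.coeff_sub]
  -- for `j ≥ 2` all Pochhammer symbols at negative integers are multiples of `(-n)_{j-2}`
  rcases j with _ | _ | j
  · simp [kummerPoly_coeff]; ring
  · simp [kummerPoly_coeff, Polynomial.coeff_derivative]; ring
  · have h32 : ∀ i : ℕ, (ascPochhammer ℝ i).eval (3 / 2 : ℝ) ≠ 0 := fun i =>
      (ascPochhammer_pos i _ (by norm_num)).ne'
    simp only [Polynomial.coeff_X_mul, Polynomial.coeff_derivative, kummerPoly_coeff]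
    have h1 : (ascPochhammer ℝ (j + 1 + 1)).eval (-((n + 2 : ℕ) : ℝ)) =
        (n + 2) * ((n + 1) * (ascPochhammer ℝ j).eval (-(n : ℝ))) := by
      rw [hp, hp]; push_cast
      rw [show (-((n : ℝ) + 2) + 1 + 1) = -n by ring]; ring
    have h2 : (ascPochhammer ℝ (j + 1)).eval (-((n + 1 : ℕ) : ℝ)) =
        -(n + 1) * (ascPochhammer ℝ j).eval (-(n : ℝ)) := by
      rw [hp]; push_cast
      rw [show (-((n : ℝ) + 1) + 1) = -n by ring]
    rw [hs (j + 1) (-((n + 1 : ℕ) : ℝ)), h1, h2, hs (j + 1) (-(n : ℝ)), hs j (-(n : ℝ)),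
      hs (j + 1) (3 / 2), hs j (3 / 2), Nat.factorial_succ (j + 1), Nat.factorial_succ j]
    have := h32 j
    have hf : (j.factorial : ℝ) ≠ 0 := by positivity
    have h3 : (3 / 2 + j : ℝ) ≠ 0 := by positivity
    have h4 : (3 / 2 + (j + 1 : ℝ)) ≠ 0 := by positivity
    have h5 : (j + 1 : ℝ) ≠ 0 := by positivity
    have h6 : (j + 1 + 1 : ℝ) ≠ 0 := by positivity
    push_cast
    field_simp
    ring

lemma kummerPoly_zero : kummerPoly 0 = 1 := by simp [kummerPoly]

/-- The three-term relation at its lower end, where `P_{-1}` has the factor `0`. -/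
lemma two_eulerOp_kummerPoly_zero :
    Polynomial.C (3 / 2 : ℝ) * kummerPoly 1 = Polynomial.C 2 * eulerOp (kummerPoly 0) := by
  rw [kummerPoly_zero]
  simp only [kummerPoly, eulerOp, Finset.sum_range_succ]
  ext j
  simp [Polynomial.coeff_C, Polynomial.coeff_X, Polynomial.coeff_one]
  split_ifs <;> norm_num

lemma kummerPoly_eval_zero (n : ℕ) : (kummerPoly n).eval 0 = 1 := by
  rw [← Polynomial.coeff_zero_eq_eval_zero, kummerPoly_coeff]; simp

/-- `(-1)^n ₂F₁(-n, 1; 3/2; 2) > 0`: integrating the three-term relation against `e^{-y}` gives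
`(n + 3/2) C_{n+1} = n C_{n-1} - C_n / 2`, and the signs propagate. -/
lemma expMoment_kummerPoly_sign (n : ℕ) : 0 < (-1) ^ n * expMoment (kummerPoly n) := by
  have hC : ∀ (a : ℝ) (p : Polynomial ℝ), expMoment (Polynomial.C a * p) = a * expMoment p := by
    intro a p; rw [← Polynomial.smul_eq_C_mul, map_smul, smul_eq_mul]
  have h0 : expMoment (kummerPoly 0) = 1 := by
    rw [← hypConst_neg_nat, hypConst, ordinaryHypergeometric_eq_tsum]
    beta_reduce
    rw [tsum_eq_single 0]
    · simp
    · intro j hj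
      rw [ascPochhammer_eval_neg_nat (Nat.pos_of_ne_zero hj)]
      simp
  induction n using Nat.twoStepInduction with
  | zero => rw [h0]; norm_num
  | one =>
    have h := congrArg expMoment two_eulerOp_kummerPoly_zero
    rw [hC, hC, expMoment_eulerOp, h0] at h
    linarith
  | more n ih1 ih2 =>
    have h := congrArg expMoment (kummerPoly_rec n)
    rw [hC, map_add, hC, hC, expMoment_eulerOp] at h
    have hn : (0 : ℝ) ≤ n := n.cast_nonneg
    have : (n + 1 + 3 / 2 : ℝ) * ((-1) ^ (n + 2) * expMoment (kummerPoly (n + 2))) =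
        (n + 1) * ((-1) ^ n * expMoment (kummerPoly n)) +
          1 / 2 * ((-1) ^ (n + 1) * expMoment (kummerPoly (n + 1))) := by
      rw [pow_succ, pow_succ]
      linear_combination (-1) ^ n * h
    have hpos : 0 < (n + 1 + 3 / 2 : ℝ) * ((-1) ^ (n + 2) * expMoment (kummerPoly (n + 2))) := by
      rw [this]; positivity
    exact pos_of_mul_pos_right hpos (by positivity)

/-! ### The kernel `x coth (πx)` and the theta function -/

/-- The Bose–Einstein weight `x / (e^{2πx} - 1)`. -/
def boseWeight (x : ℝ) : ℝ := x / (exp (2 * π * x) - 1)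

/-- The kernel `x coth (πx)`, written as `x + 2x / (e^{2πx} - 1)`. -/
def cothKernel (x : ℝ) : ℝ := x + 2 * boseWeight x

/-- The partial fraction expansion of `πx coth (πx)`, from that of the cotangent at `ix`. -/
lemma hasSum_cothKernel {x : ℝ} (hx : 0 < x) :
    HasSum (fun m : ℤ => x ^ 2 / (x ^ 2 + (m : ℝ) ^ 2)) (π * cothKernel x) := by
  have hxC : (x : ℂ) ≠ 0 := by exact_mod_cast hx.ne'
  have hz : Complex.I * x ∈ Complex.integerComplement := by
    rintro ⟨n, hn⟩
    have := congrArg Complex.im hn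
    simp at this
    exact hx.ne this
  have h1 := (summable_cotTerm hz).hasSum
  have h2 := cot_series_rep' hz
  simp only [cotTerm] at h1
  rw [← h2, Complex.cot_pi_eq_exp_ratio] at h1
  have he : Complex.exp (2 * π * Complex.I * (Complex.I * x)) = (exp (-(2 * π * x)) : ℝ) := by
    push_cast
    congr 1
    linear_combination 2 * π * x * Complex.I_mul_I
  rw [he] at h1
  have hlt : exp (-(2 * π * x)) < 1 := by
    rw [exp_lt_one_iff]; have := pi_pos; nlinarith [mul_pos pi_pos hx]
  have hne : 1 - exp (-(2 * π * x)) ≠ 0 := (sub_pos.2 hlt).ne'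
  have hk : cothKernel x = x * (exp (-(2 * π * x)) + 1) / (1 - exp (-(2 * π * x))) := by
    have he' : exp (2 * π * x) = (exp (-(2 * π * x)))⁻¹ := by rw [exp_neg, inv_inv]
    have hpos := exp_pos (-(2 * π * x))
    rw [cothKernel, boseWeight, he']
    generalize exp (-(2 * π * x)) = u at hne hpos
    have : u⁻¹ - 1 ≠ 0 := by
      intro h
      have hu : u⁻¹ = 1 := by linarith
      rw [inv_eq_one] at hu
      exact hne (by rw [hu, sub_self])
    field_simp
    ring
  have h4 : HasSum (fun n : ℕ => x ^ 2 / (x ^ 2 + (n + 1 : ℝ) ^ 2))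
      ((π * cothKernel x - 1) / 2) := by
    rw [← Complex.hasSum_ofReal]
    convert! h1.mul_left (Complex.I * x / 2) using 1
    · funext n
      have ha : Complex.I * x - (n + 1) ≠ 0 := by
        intro h0
        have := congrArg Complex.im h0
        simp at this
        exact hx.ne' this
      have hb : Complex.I * x + (n + 1) ≠ 0 := by
        intro h0
        have := congrArg Complex.im h0
        simp at this
        exact hx.ne' this
      have hc : (x : ℂ) ^ 2 + (n + 1) ^ 2 ≠ 0 := by
        have : (0 : ℝ) < x ^ 2 + (n + 1) ^ 2 := by positivity
        exact_mod_cast this.ne'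
      push_cast
      rw [div_add_div _ _ ha hb, mul_div_assoc', div_eq_div_iff hc (mul_ne_zero ha hb)]
      linear_combination (x : ℂ) ^ 2 * (x ^ 2 - (x ^ 2 + (n + 1) ^ 2)) * Complex.I_sq
    · rw [hk]
      have hneC : (1 : ℂ) - (exp (-(2 * π * x)) : ℝ) ≠ 0 := by exact_mod_cast hne
      push_cast at hneC ⊢
      have hI := Complex.I_ne_zero
      field_simp
  have h5 : HasSum (fun m : ℤ => x ^ 2 / (x ^ 2 + (m : ℝ) ^ 2)) _ :=
    HasSum.of_add_one_of_neg_add_one (by simpa using h4)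
      (m' := (π * cothKernel x - 1) / 2) (by
        convert! h4 using 3 with n
        push_cast
        ring)
  convert! h5 using 1
  have : x ^ 2 ≠ 0 := by positivity
  simp [this]
  ring

/-- The theta series `∑_{m ∈ ℤ} e^{-m² t}` with values in `[0, ∞]`. -/
def thetaE (t : ℝ) : ENNReal := ∑' m : ℤ, ENNReal.ofReal (exp (-t * (m : ℝ) ^ 2))

lemma measurable_thetaE : Measurable thetaE :=
  Measurable.tsum fun m => by fun_prop

/-- Jacobi's functional equation of the theta series. -/
lemma thetaE_functional {t : ℝ} (ht : 0 < t) :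
    thetaE t = ENNReal.ofReal ((π / t) ^ (1 / 2 : ℝ)) * thetaE (π ^ 2 / t) := by
  have hs : ∀ {s : ℝ}, 0 < s → Summable fun m : ℤ => exp (-s * (m : ℝ) ^ 2) := by
    intro s hs
    refine (summable_pow_mul_jacobiTheta₂_term_bound 0 (div_pos hs pi_pos) 0).congr fun m => ?_
    simp only [pow_zero, one_mul, mul_zero, zero_mul, sub_zero]
    congr 1
    field_simp
  have hpos : 0 < π ^ 2 / t := by positivity
  rw [thetaE, thetaE, ← ENNReal.ofReal_tsum_of_nonneg (fun _ => (exp_pos _).le) (hs ht),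
    ← ENNReal.ofReal_tsum_of_nonneg (fun _ => (exp_pos _).le) (hs hpos),
    ← ENNReal.ofReal_mul (by positivity)]
  congr 1
  have h := Real.tsum_exp_neg_mul_int_sq (a := t / π) (by positivity)
  have e1 : -π * (t / π) = -t := by field_simp
  have e2 : -π / (t / π) = -(π ^ 2 / t) := by field_simp
  rw [e1, e2] at h
  rw [h, one_div, ← inv_rpow (by positivity), inv_div]

lemma lintegral_thetaE_cothKernel {x : ℝ} (hx : 0 < x) :
    ∫⁻ t in Ioi (0 : ℝ), ENNReal.ofReal (x ^ 2 * exp (-t * x ^ 2)) * thetaE t =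
      ENNReal.ofReal (π * cothKernel x) := by
  have hterm : ∀ m : ℤ, ∫⁻ t in Ioi (0 : ℝ), ENNReal.ofReal (x ^ 2 * exp (-t * x ^ 2)) *
      ENNReal.ofReal (exp (-t * (m : ℝ) ^ 2)) = ENNReal.ofReal (x ^ 2 / (x ^ 2 + (m : ℝ) ^ 2)) := by
    intro m
    have hb : -(x ^ 2 + (m : ℝ) ^ 2) < 0 := by have := sq_nonneg (m : ℝ); have := pow_pos hx 2; linarith
    have hi := (integrableOn_exp_mul_Ioi hb 0).const_mul (x ^ 2)
    have hv := integral_exp_mul_Ioi hb 0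
    calc _ = ∫⁻ t in Ioi (0 : ℝ),
          ENNReal.ofReal (x ^ 2 * exp (-(x ^ 2 + (m : ℝ) ^ 2) * t)) := by
          refine lintegral_congr fun t => ?_
          rw [← ENNReal.ofReal_mul (by positivity), mul_assoc, ← exp_add]
          congr 3
          ring
      _ = _ := by
          rw [← ofReal_integral_eq_lintegral_ofReal hi (ae_of_all _ fun t => by positivity),
            integral_const_mul, hv]
          congr 1
          rw [mul_zero, exp_zero, neg_div_neg_eq, mul_one_div]
  simp only [thetaE, ← ENNReal.tsum_mul_left]
  rw [lintegral_tsum (fun m => by fun_prop)]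
  simp only [hterm]
  rw [← ENNReal.ofReal_tsum_of_nonneg (fun _ => by positivity) (hasSum_cothKernel hx).summable,
    (hasSum_cothKernel hx).tsum_eq]

lemma lintegral_sq_mul_exp_neg_mul_sq {b : ℝ} (hb : 0 < b) :
    ∫⁻ x in Ioi (0 : ℝ), ENNReal.ofReal (x ^ 2 * exp (-b * x ^ 2)) =
      ENNReal.ofReal (√π / 4) * ENNReal.ofReal (b ^ (-3 / 2 : ℝ)) := by
  have hv := integral_rpow_mul_exp_neg_mul_rpow (p := 2) (q := 2) (b := b) (by norm_num)
    (by norm_num) hb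
  have hi : IntegrableOn (fun x : ℝ => x ^ 2 * exp (-b * x ^ 2)) (Ioi 0) := by
    have := integrableOn_rpow_mul_exp_neg_mul_sq hb (s := 2) (by norm_num)
    simpa [rpow_two] using this
  rw [← ofReal_integral_eq_lintegral_ofReal hi (ae_of_all _ fun t => by positivity),
    ← ENNReal.ofReal_mul (by positivity)]
  congr 1
  simp only [rpow_two] at hv
  rw [hv, show ((2 : ℝ) + 1) / 2 = 1 / 2 + 1 by norm_num, Gamma_add_one (by norm_num),
    Gamma_one_half_eq]
  norm_num
  ring

/-- By Tonelli, the Gaussian integral of `x coth (πx)` is a Stieltjes-type transform of theta. -/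
lemma lintegral_cothKernel {α : ℝ} (hα : 0 < α) :
    ENNReal.ofReal π * ∫⁻ x in Ioi (0 : ℝ), ENNReal.ofReal (cothKernel x * exp (-α * x ^ 2)) =
      ENNReal.ofReal (√π / 4) *
        ∫⁻ t in Ioi (0 : ℝ), thetaE t * ENNReal.ofReal ((t + α) ^ (-3 / 2 : ℝ)) := by
  have hm := measurable_thetaE
  have hmk : Measurable cothKernel := by unfold cothKernel boseWeight; fun_prop
  calc _ = ∫⁻ x in Ioi (0 : ℝ), ∫⁻ t in Ioi (0 : ℝ),
        thetaE t * ENNReal.ofReal (x ^ 2 * exp (-(t + α) * x ^ 2)) := by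
        rw [← lintegral_const_mul _ (by fun_prop)]
        refine setLIntegral_congr_fun measurableSet_Ioi fun x hx => ?_
        rw [← ENNReal.ofReal_mul pi_pos.le, ← mul_assoc, ENNReal.ofReal_mul' (exp_pos _).le,
          ← lintegral_thetaE_cothKernel hx, ← lintegral_mul_const _ (by fun_prop)]
        refine lintegral_congr fun t => ?_
        rw [mul_comm, ← mul_assoc, ← ENNReal.ofReal_mul (exp_pos _).le, mul_comm (thetaE t)]
        congr 2
        rw [mul_left_comm, ← exp_add]
        congr 2
        ring
    _ = ∫⁻ t in Ioi (0 : ℝ), ∫⁻ x in Ioi (0 : ℝ),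
        thetaE t * ENNReal.ofReal (x ^ 2 * exp (-(t + α) * x ^ 2)) :=
        lintegral_lintegral_swap (by fun_prop)
    _ = _ := by
        rw [← lintegral_const_mul _ (by fun_prop)]
        refine setLIntegral_congr_fun measurableSet_Ioi fun t ht => ?_
        have ht' : 0 < t + α := add_pos ht hα
        rw [lintegral_const_mul _ (by fun_prop), lintegral_sq_mul_exp_neg_mul_sq ht',
          mul_left_comm]

/-- The Jacobian of `s ↦ π²/s`, the factor of the theta function and the kernel `(t + α)^{-3/2}`
combine to the kernel with `β = π²/α`. -/
lemma inversion_weight {α β s : ℝ} (hα : 0 < α) (hβ : 0 < β) (hs : 0 < s) (h : α * β = π ^ 2) :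
    |-π ^ 2 / s ^ 2| * ((π / (π ^ 2 / s)) ^ (1 / 2 : ℝ) * (π ^ 2 / s + α) ^ (-3 / 2 : ℝ)) =
      (π / α) ^ (3 / 2 : ℝ) * (s + β) ^ (-3 / 2 : ℝ) := by
  have hp := pi_pos
  have e1 : π / (π ^ 2 / s) = s / π := by field_simp
  have e2 : π ^ 2 / s + α = (α / s) * (s + β) := by rw [← h]; field_simp; ring
  have e3 : |-π ^ 2 / s ^ 2| = π ^ 2 / s ^ 2 := by
    rw [neg_div, abs_neg, abs_of_pos (by positivity)]
  have h32 : ∀ y : ℝ, 0 < y → y ^ (3 / 2 : ℝ) = y * y ^ (1 / 2 : ℝ) := by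
    intro y hy
    rw [show (3 / 2 : ℝ) = 1 + 1 / 2 by norm_num, rpow_add hy, rpow_one]
  have hn32 : ∀ y : ℝ, 0 < y → y ^ (-3 / 2 : ℝ) = (y * y ^ (1 / 2 : ℝ))⁻¹ := by
    intro y hy
    rw [neg_div, rpow_neg hy.le, h32 y hy]
  have hsq : (π ^ (1 / 2 : ℝ)) ^ 2 = π := by
    rw [← rpow_natCast, ← rpow_mul hp.le]; norm_num
  rw [e1, e2, e3, mul_rpow (by positivity) (by positivity), hn32 (α / s) (by positivity),
    h32 (π / α) (by positivity), div_rpow hs.le hp.le, div_rpow hα.le hs.le, div_rpow hp.le hα.le]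
  have := rpow_pos_of_pos hp (1 / 2)
  have := rpow_pos_of_pos hs (1 / 2)
  have := rpow_pos_of_pos hα (1 / 2)
  have hs2 : (s ^ (1 / 2 : ℝ)) ^ 2 = s := by
    rw [← rpow_natCast, ← rpow_mul hs.le]; norm_num
  field_simp
  rw [hs2, hsq]
  ring

lemma lintegral_thetaE_symm {α β : ℝ} (hα : 0 < α) (hβ : 0 < β) (h : α * β = π ^ 2) :
    ∫⁻ t in Ioi (0 : ℝ), thetaE t * ENNReal.ofReal ((t + α) ^ (-3 / 2 : ℝ)) =
      ENNReal.ofReal ((π / α) ^ (3 / 2 : ℝ)) *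
        ∫⁻ t in Ioi (0 : ℝ), thetaE t * ENNReal.ofReal ((t + β) ^ (-3 / 2 : ℝ)) := by
  have hm := measurable_thetaE
  have himg : (fun s : ℝ => π ^ 2 / s) '' Ioi 0 = Ioi 0 := by
    ext t
    constructor
    · rintro ⟨s, hs, rfl⟩
      have hs' : 0 < s := hs
      exact mem_Ioi.2 (by positivity)
    · intro ht
      have ht' : 0 < t := ht
      exact ⟨π ^ 2 / t, mem_Ioi.2 (by positivity), div_div_cancel₀ (by positivity)⟩
  have hinj : InjOn (fun s : ℝ => π ^ 2 / s) (Ioi 0) := by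
    intro a ha b hb hab
    have ha' : 0 < a := ha
    have hb' : 0 < b := hb
    have hp : π ^ 2 ≠ 0 := by positivity
    beta_reduce at hab
    rw [div_eq_div_iff ha'.ne' hb'.ne'] at hab
    exact (mul_left_cancel₀ hp hab).symm
  have hder : ∀ s ∈ Ioi (0 : ℝ),
      HasDerivWithinAt (fun s : ℝ => π ^ 2 / s) (-π ^ 2 / s ^ 2) (Ioi 0) s := by
    intro s hs
    have := ((hasDerivAt_const s (π ^ 2)).div (hasDerivAt_id s) (ne_of_gt hs)).hasDerivWithinAt
      (s := Ioi 0)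
    convert! this using 1
    simp
  have := lintegral_image_eq_lintegral_abs_deriv_mul measurableSet_Ioi hder hinj
    (fun t => thetaE t * ENNReal.ofReal ((t + α) ^ (-3 / 2 : ℝ)))
  rw [himg] at this
  rw [this, ← lintegral_const_mul _ (by fun_prop)]
  refine setLIntegral_congr_fun measurableSet_Ioi fun s hs => ?_
  have hs' : 0 < s := hs
  have hw := inversion_weight hα hβ hs' h
  rw [thetaE_functional (t := π ^ 2 / s) (by positivity), div_div_cancel₀ (by positivity)]
  calc _ = ENNReal.ofReal |-π ^ 2 / s ^ 2| * (ENNReal.ofReal ((π / (π ^ 2 / s)) ^ (1 / 2 : ℝ)) *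
        ENNReal.ofReal ((π ^ 2 / s + α) ^ (-3 / 2 : ℝ))) * thetaE s := by ring
    _ = _ := by
      rw [← ENNReal.ofReal_mul (by positivity), ← ENNReal.ofReal_mul (by positivity), hw,
        ENNReal.ofReal_mul (by positivity)]
      ring

/-! ### Gaussian moments and their symmetry -/

/-- The Gaussian moment `∫₀^∞ w(x) e^{-αx²} p(αx²) dx` of a weight `w` against a polynomial in
`αx²`. -/
def gaussMoment (w : ℝ → ℝ) (p : Polynomial ℝ) (α : ℝ) : ℝ :=
  ∫ x in Ioi (0 : ℝ), w x * (exp (-(α * x ^ 2)) * p.eval (α * x ^ 2))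

lemma exists_abs_eval_mul_exp_neg_le (p : Polynomial ℝ) :
    ∃ C : ℝ, 0 ≤ C ∧ ∀ y : ℝ, 0 ≤ y → |exp (-y) * p.eval y| ≤ C * exp (-(y / 2)) := by
  suffices h : ∃ C : ℝ, 0 ≤ C ∧ ∀ y : ℝ, 0 ≤ y → |p.eval y| ≤ C * exp (y / 2) by
    obtain ⟨C, hC, h⟩ := h
    refine ⟨C, hC, fun y hy => ?_⟩
    rw [abs_mul, abs_of_pos (exp_pos _), show -(y / 2) = -y + y / 2 by ring, exp_add,
      mul_left_comm]
    exact mul_le_mul_of_nonneg_left (h y hy) (exp_pos _).le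
  induction p using Polynomial.induction_on' with
  | add p q hp hq =>
    obtain ⟨C, hC, hp⟩ := hp
    obtain ⟨D, hD, hq⟩ := hq
    refine ⟨C + D, by positivity, fun y hy => ?_⟩
    rw [Polynomial.eval_add, add_mul]
    exact (abs_add_le _ _).trans (add_le_add (hp y hy) (hq y hy))
  | monomial j a =>
    refine ⟨|a| * (2 ^ j * j.factorial), by positivity, fun y hy => ?_⟩
    have := pow_div_factorial_le_exp (y / 2) (by positivity) j
    rw [div_le_iff₀ (by positivity), div_pow, div_le_iff₀ (by positivity)] at this
    rw [Polynomial.eval_monomial, abs_mul, abs_of_nonneg (pow_nonneg hy j), mul_assoc]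
    refine mul_le_mul_of_nonneg_left (this.trans_eq (by ring)) (abs_nonneg a)

lemma integrableOn_one_add_mul_exp {b : ℝ} (hb : 0 < b) :
    IntegrableOn (fun x : ℝ => (1 + x) * exp (-(b * x ^ 2))) (Ioi 0) := by
  have h1 := (integrable_exp_neg_mul_sq hb).integrableOn (s := Ioi 0)
  have h2 := (integrable_mul_exp_neg_mul_sq hb).integrableOn (s := Ioi 0)
  refine (h1.add h2).congr (ae_of_all _ fun x => ?_)
  simp only [Pi.add_apply, neg_mul]
  ring

section Moments

variable {w : ℝ → ℝ}

lemma integrableOn_gaussMoment (hwm : Measurable w) (hw : ∀ x, 0 < x → |w x| ≤ 1 + x)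
    (p : Polynomial ℝ) {α : ℝ} (hα : 0 < α) :
    IntegrableOn (fun x => w x * (exp (-(α * x ^ 2)) * p.eval (α * x ^ 2))) (Ioi 0) := by
  obtain ⟨C, hC, h⟩ := exists_abs_eval_mul_exp_neg_le p
  refine Integrable.mono' ((integrableOn_one_add_mul_exp (half_pos hα)).const_mul C)
    (by fun_prop) ((ae_restrict_iff' measurableSet_Ioi).2 (ae_of_all _ fun x hx => ?_))
  have hx' : 0 < x := hx
  rw [norm_mul, norm_eq_abs, norm_eq_abs]
  calc _ ≤ (1 + x) * (C * exp (-(α * x ^ 2 / 2))) :=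
        mul_le_mul (hw x hx) (h _ (by positivity)) (abs_nonneg _) (by positivity)
    _ = _ := by rw [show α * x ^ 2 / 2 = α / 2 * x ^ 2 by ring]; ring

lemma hasDerivAt_gaussMoment (hwm : Measurable w) (hw : ∀ x, 0 < x → |w x| ≤ 1 + x)
    (p : Polynomial ℝ) {α : ℝ} (hα : 0 < α) :
    HasDerivAt (gaussMoment w p)
      (gaussMoment w (Polynomial.X * Polynomial.derivative p - Polynomial.X * p) α / α) α := by
  set q := Polynomial.X * Polynomial.derivative p - Polynomial.X * p with hq
  obtain ⟨C, hC, h⟩ := exists_abs_eval_mul_exp_neg_le q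
  have hmeas : ∀ (r : Polynomial ℝ) (a : ℝ), AEStronglyMeasurable
      (fun x => w x * (exp (-(a * x ^ 2)) * r.eval (a * x ^ 2))) (volume.restrict (Ioi 0)) :=
    fun r a => by fun_prop
  have key := (hasDerivAt_integral_of_dominated_loc_of_deriv_le (μ := volume.restrict (Ioi 0))
    (F := fun a x => w x * (exp (-(a * x ^ 2)) * p.eval (a * x ^ 2)))
    (F' := fun a x => w x * (exp (-(a * x ^ 2)) * q.eval (a * x ^ 2)) / a)
    (bound := fun x => C / (α / 2) * ((1 + x) * exp (-(α / 4 * x ^ 2))))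
    -- on `a > α/2` the factor `e^{-ax²/2}` of the bound is at most `e^{-αx²/4}`
    (Ioi_mem_nhds (half_lt_self hα)) (Eventually.of_forall (hmeas p))
    (integrableOn_gaussMoment hwm hw p hα) (by fun_prop) ?_
    ((integrableOn_one_add_mul_exp (by positivity)).const_mul _) ?_).2
  · rw [integral_div] at key
    exact key
  · refine (ae_restrict_iff' measurableSet_Ioi).2 (ae_of_all _ fun x hx a ha => ?_)
    have hx' : 0 < x := hx
    have ha' : α / 2 < a := ha
    have ha0 : 0 < a := (half_pos hα).trans ha'
    rw [norm_div, norm_mul, norm_eq_abs, norm_eq_abs, norm_of_nonneg ha0.le]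
    calc _ ≤ (1 + x) * (C * exp (-(α / 4 * x ^ 2))) / (α / 2) := by
          refine div_le_div₀ (by positivity) (mul_le_mul (hw x hx) ((h _ (by positivity)).trans ?_)
            (abs_nonneg _) (by positivity)) (by positivity) ha'.le
          gcongr
          nlinarith [mul_pos hx' hx']
      _ = _ := by ring
  · refine (ae_restrict_iff' measurableSet_Ioi).2 (ae_of_all _ fun x hx a ha => ?_)
    have ha0 : 0 < a := (half_pos hα).trans ha
    have h1 : HasDerivAt (fun a : ℝ => a * x ^ 2) (x ^ 2) a := by
      simpa using (hasDerivAt_id a).mul_const (x ^ 2)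
    have h2 := ((h1.neg.exp).mul ((p.hasDerivAt (a * x ^ 2)).comp a h1)).const_mul (w x)
    refine h2.congr_deriv ?_
    simp only [hq, Polynomial.eval_sub, Polynomial.eval_mul, Polynomial.eval_X, Function.comp,
      Pi.neg_apply]
    field_simp
    ring

/-- Normalised by `α^{3/4}`, the moment has Euler derivative `α d/dα` given by `eulerOp`. -/
lemma hasDerivAt_rpow_mul_gaussMoment (hwm : Measurable w) (hw : ∀ x, 0 < x → |w x| ≤ 1 + x)
    (p : Polynomial ℝ) {α : ℝ} (hα : 0 < α) :
    HasDerivAt (fun a => a ^ (3 / 4 : ℝ) * gaussMoment w p a)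
      (α ^ (3 / 4 : ℝ) * gaussMoment w (eulerOp p) α / α) α := by
  have h1 := (hasDerivAt_rpow_const (p := 3 / 4) (Or.inl hα.ne')).mul
    (hasDerivAt_gaussMoment hwm hw p hα)
  refine h1.congr_deriv ?_
  have h2 : gaussMoment w (eulerOp p) α = 3 / 4 * gaussMoment w p α +
      gaussMoment w (Polynomial.X * Polynomial.derivative p - Polynomial.X * p) α := by
    simp only [gaussMoment]
    rw [← integral_const_mul, ← integral_add ((integrableOn_gaussMoment hwm hw p hα).const_mul _)
      (integrableOn_gaussMoment hwm hw _ hα)]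
    congr 1
    funext x
    rw [eulerOp, Polynomial.eval_add, Polynomial.eval_mul, Polynomial.eval_C]
    ring
  rw [h2, rpow_sub_one hα.ne']
  ring

lemma gaussMoment_add (hwm : Measurable w) (hw : ∀ x, 0 < x → |w x| ≤ 1 + x)
    (p q : Polynomial ℝ) {α : ℝ} (hα : 0 < α) :
    gaussMoment w (p + q) α = gaussMoment w p α + gaussMoment w q α := by
  simp only [gaussMoment]
  rw [← integral_add (integrableOn_gaussMoment hwm hw p hα)
    (integrableOn_gaussMoment hwm hw q hα)]
  congr 1
  funext x
  rw [Polynomial.eval_add]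
  ring

lemma gaussMoment_C_mul (w : ℝ → ℝ) (c : ℝ) (p : Polynomial ℝ) (α : ℝ) :
    gaussMoment w (Polynomial.C c * p) α = c * gaussMoment w p α := by
  simp only [gaussMoment]
  rw [← integral_const_mul]
  congr 1
  funext x
  rw [Polynomial.eval_mul, Polynomial.eval_C]
  ring

end Moments

lemma measurable_boseWeight : Measurable boseWeight := by unfold boseWeight; fun_prop

lemma measurable_cothKernel : Measurable cothKernel :=
  measurable_id.add (measurable_boseWeight.const_mul 2)

lemma two_pi_mul_lt_exp_sub_one {x : ℝ} (hx : 0 < x) : 2 * π * x < exp (2 * π * x) - 1 := by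
  have := add_one_lt_exp (x := 2 * π * x) (by positivity)
  linarith

lemma boseWeight_nonneg {x : ℝ} (hx : 0 < x) : 0 ≤ boseWeight x :=
  div_nonneg hx.le ((by positivity : 0 ≤ 2 * π * x).trans (two_pi_mul_lt_exp_sub_one hx).le)

lemma boseWeight_le {x : ℝ} (hx : 0 < x) : boseWeight x ≤ 1 / 2 := by
  have h := two_pi_mul_lt_exp_sub_one hx
  have h0 : 0 < 2 * π * x := by positivity
  rw [boseWeight, div_le_iff₀ (h0.trans h)]
  nlinarith [pi_gt_three]

lemma abs_cothKernel_le (x : ℝ) (hx : 0 < x) : |cothKernel x| ≤ 1 + x := by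
  have h1 := boseWeight_nonneg hx
  have h2 := boseWeight_le hx
  rw [cothKernel, abs_of_nonneg (by positivity)]
  linarith

lemma abs_boseWeight_le (x : ℝ) (hx : 0 < x) : |boseWeight x| ≤ 1 + x := by
  rw [abs_of_nonneg (boseWeight_nonneg hx)]
  linarith [boseWeight_le hx]

lemma gaussMoment_id (p : Polynomial ℝ) {α : ℝ} (hα : 0 < α) :
    gaussMoment (fun x => x) p α = expMoment p / (2 * α) := by
  have hw : ∀ x : ℝ, 0 < x → |x| ≤ 1 + x := fun x hx => by rw [abs_of_pos hx]; linarith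
  induction p using Polynomial.induction_on' with
  | add p q hp hq =>
    rw [gaussMoment_add (w := fun x => x) measurable_id hw p q hα, hp, hq, map_add, add_div]
  | monomial j a =>
    have hv := integral_rpow_mul_exp_neg_mul_rpow (p := 2) (q := (2 * j + 1 : ℕ)) (by norm_num)
      (by linarith [Nat.cast_nonneg (α := ℝ) (2 * j + 1)]) hα
    have hj : (((2 * j + 1 : ℕ) : ℝ) + 1) / 2 = j + 1 := by push_cast; ring
    rw [neg_div, hj, Gamma_nat_eq_factorial] at hv
    have : gaussMoment (fun x => x) (Polynomial.monomial j a) α =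
        a * α ^ j * ∫ x in Ioi (0 : ℝ), x ^ ((2 * j + 1 : ℕ) : ℝ) * exp (-α * x ^ (2 : ℝ)) := by
      rw [gaussMoment, ← integral_const_mul]
      congr 1
      funext x
      rw [Polynomial.eval_monomial, rpow_natCast, rpow_two, neg_mul]
      ring
    rw [this, hv, expMoment, Polynomial.lsum_apply, Polynomial.sum_monomial_index _ _ (by simp),
      rpow_neg hα.le, rpow_add_one hα.ne', rpow_natCast]
    simp only [LinearMap.smul_apply, LinearMap.id_apply, smul_eq_mul]
    field_simp

/-- `α^{3/4} ∫₀^∞ x coth(πx) e^{-αx²} ₁F₁(-n; 3/2; 2αx²) dx`. -/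
def cothMoment (n : ℕ) (α : ℝ) : ℝ := α ^ (3 / 4 : ℝ) * gaussMoment cothKernel (kummerPoly n) α

/-- Ramanujan's case `n = 0` of the symmetry. -/
lemma cothMoment_zero_symm {α β : ℝ} (hα : 0 < α) (hβ : 0 < β) (h : α * β = π ^ 2) :
    cothMoment 0 β = cothMoment 0 α := by
  have hp := pi_pos
  set A : ℝ → ENNReal := fun a =>
    ∫⁻ x in Ioi (0 : ℝ), ENNReal.ofReal (cothKernel x * exp (-a * x ^ 2)) with hA
  have hAeq : A α = ENNReal.ofReal ((π / α) ^ (3 / 2 : ℝ)) * A β := by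
    have h1 := lintegral_cothKernel hα
    rw [lintegral_thetaE_symm hα hβ h, mul_left_comm, ← lintegral_cothKernel hβ,
      mul_left_comm] at h1
    exact (ENNReal.mul_right_inj (ENNReal.ofReal_pos.2 hp).ne' ENNReal.ofReal_ne_top).1 h1
  have hM : ∀ a : ℝ, gaussMoment cothKernel (kummerPoly 0) a = (A a).toReal := by
    intro a
    have hmk := measurable_cothKernel
    rw [gaussMoment, integral_eq_lintegral_of_nonneg_ae ?_ (by fun_prop)]
    · simp [hA, kummerPoly_zero]
    · refine (ae_restrict_iff' measurableSet_Ioi).2 (ae_of_all _ fun x hx => ?_)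
      have := boseWeight_nonneg hx
      have hx' : 0 < x := hx
      simp only [kummerPoly_zero, Polynomial.eval_one, cothKernel, Pi.zero_apply]
      positivity
  rw [cothMoment, cothMoment, hM, hM, hAeq, ENNReal.toReal_mul,
    ENNReal.toReal_ofReal (by positivity), ← mul_assoc]
  congr 1
  have hb : β = π ^ 2 / α := by field_simp; linarith
  have e : (π ^ 2) ^ (3 / 4 : ℝ) = π ^ (3 / 2 : ℝ) := by
    rw [← rpow_natCast, ← rpow_mul hp.le]; norm_num
  rw [hb, div_rpow (by positivity) hα.le, e, div_rpow hp.le hα.le,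
    show (3 / 2 : ℝ) = 3 / 4 + 3 / 4 by norm_num, rpow_add hα]
  have := rpow_pos_of_pos hα (3 / 4)
  field_simp

/-- A symmetry of the moment of `p` under `α ↦ π²/α` passes with the opposite sign to the moment
of its image under `eulerOp`: the derivation `α d/dα` changes sign under the inversion. -/
lemma gaussMoment_eulerOp_symm {p : Polynomial ℝ} {ε : ℝ}
    (h : ∀ a : ℝ, 0 < a → (π ^ 2 / a) ^ (3 / 4 : ℝ) * gaussMoment cothKernel p (π ^ 2 / a) =
      ε * (a ^ (3 / 4 : ℝ) * gaussMoment cothKernel p a)) {α : ℝ} (hα : 0 < α) :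
    (π ^ 2 / α) ^ (3 / 4 : ℝ) * gaussMoment cothKernel (eulerOp p) (π ^ 2 / α) =
      -ε * (α ^ (3 / 4 : ℝ) * gaussMoment cothKernel (eulerOp p) α) := by
  have hd := fun {a : ℝ} (ha : 0 < a) =>
    hasDerivAt_rpow_mul_gaussMoment measurable_cothKernel abs_cothKernel_le p ha
  have hβ : 0 < π ^ 2 / α := by positivity
  have hinv : HasDerivAt (fun a : ℝ => π ^ 2 / a) (-π ^ 2 / α ^ 2) α := by
    convert! (hasDerivAt_const α (π ^ 2)).div (hasDerivAt_id α) hα.ne' using 1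
    simp
  have h1 := (hd hβ).comp α hinv
  have h2 := (hd hα).const_mul ε
  have h3 := h1.unique (h2.congr_of_eventuallyEq
    ((eventually_gt_nhds hα).mono fun a ha => h a ha))
  field_simp at h3
  linarith

lemma cothMoment_symm (n : ℕ) {α : ℝ} (hα : 0 < α) :
    cothMoment n (π ^ 2 / α) = (-1) ^ n * cothMoment n α := by
  have hadd := fun p q {a : ℝ} (ha : 0 < a) =>
    gaussMoment_add measurable_cothKernel abs_cothKernel_le p q ha
  induction n using Nat.twoStepInduction generalizing α with
  | zero =>
    rw [pow_zero, one_mul]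
    exact cothMoment_zero_symm hα (by positivity) (by field_simp)
  | one =>
    have h0 := gaussMoment_eulerOp_symm (p := kummerPoly 0) (ε := 1) (fun a ha => by
      rw [one_mul]; exact cothMoment_zero_symm ha (by positivity) (by field_simp)) hα
    have h1 := fun a => congrArg (gaussMoment cothKernel · a) two_eulerOp_kummerPoly_zero
    simp only [gaussMoment_C_mul] at h1
    rw [cothMoment, cothMoment]
    linear_combination 4 / 3 * h0 + 2 / 3 * (π ^ 2 / α) ^ (3 / 4 : ℝ) * h1 (π ^ 2 / α) +
      2 / 3 * α ^ (3 / 4 : ℝ) * h1 α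
  | more n ih1 ih2 =>
    have h0 := gaussMoment_eulerOp_symm (p := kummerPoly (n + 1)) (fun a ha => ih2 ha) hα
    have h1 : ∀ a : ℝ, 0 < a → (n + 1 + 3 / 2 : ℝ) * cothMoment (n + 2) a =
        (n + 1) * cothMoment n a +
          2 * (a ^ (3 / 4 : ℝ) * gaussMoment cothKernel (eulerOp (kummerPoly (n + 1))) a) := by
      intro a ha
      have h := congrArg (gaussMoment cothKernel · a) (kummerPoly_rec n)
      beta_reduce at h
      rw [gaussMoment_C_mul, hadd _ _ ha, gaussMoment_C_mul, gaussMoment_C_mul] at h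
      rw [cothMoment, cothMoment]
      linear_combination a ^ (3 / 4 : ℝ) * h
    have hn : (n + 1 + 3 / 2 : ℝ) ≠ 0 := by positivity
    refine mul_left_cancel₀ hn ?_
    rw [h1 _ (by positivity), ih1 hα, h0]
    linear_combination -(-1) ^ n * h1 α hα

/-! ### Behaviour for small parameters -/

/-- Expanding in a geometric series reduces this to `ζ(2) = π²/6`. -/
lemma integral_boseWeight : ∫ x in Ioi (0 : ℝ), boseWeight x = 1 / 24 := by
  have hterm : ∀ n : ℕ, IntegrableOn (fun x : ℝ => x * exp (-(2 * π * (n + 1)) * x)) (Ioi 0) ∧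
      ∫ x in Ioi (0 : ℝ), x * exp (-(2 * π * (n + 1)) * x) =
        1 / (4 * π ^ 2) * (1 / (n + 1 : ℝ) ^ 2) := by
    intro n
    have hb : 0 < 2 * π * (n + 1) := by positivity
    have hv := integral_rpow_mul_exp_neg_mul_rpow (p := 1) (q := 1) (by norm_num) (by norm_num) hb
    have hi := integrableOn_rpow_mul_exp_neg_mul_rpow (p := 1) (s := 1) (by norm_num) (by norm_num)
      hb
    simp only [rpow_one] at hv hi
    refine ⟨hi, ?_⟩
    rw [hv, show ((1 : ℝ) + 1) / 1 = 1 + 1 by norm_num, Gamma_add_one one_ne_zero, Gamma_one,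
      show (-(1 + 1) / 1 : ℝ) = -(2 : ℕ) by norm_num, rpow_neg hb.le, rpow_natCast]
    field_simp
    ring
  have hzeta : HasSum (fun n : ℕ => 1 / (4 * π ^ 2) * (1 / (n + 1 : ℝ) ^ 2)) (1 / 24) := by
    have h := (hasSum_nat_add_iff' 1).2 hasSum_zeta_two
    convert! h.mul_left (1 / (4 * π ^ 2)) using 1
    · funext n; push_cast; rfl
    · simp; field_simp; norm_num
  have hgeom : ∀ x ∈ Ioi (0 : ℝ),
      boseWeight x = ∑' n : ℕ, x * exp (-(2 * π * (n + 1)) * x) := by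
    intro x hx
    have hx' : 0 < x := hx
    have hlt : exp (-(2 * π * x)) < 1 := by
      rw [exp_lt_one_iff]; have : 0 < 2 * π * x := by positivity
      linarith
    have hs := ((hasSum_geometric_of_lt_one (exp_pos _).le hlt).mul_left
      (x * exp (-(2 * π * x)))).tsum_eq
    rw [boseWeight, div_eq_mul_inv, show (exp (2 * π * x) - 1)⁻¹ =
      exp (-(2 * π * x)) * (1 - exp (-(2 * π * x)))⁻¹ by
        rw [exp_neg]
        have h1 : exp (2 * π * x) - 1 ≠ 0 := by
          have : 0 < 2 * π * x := by positivity
          have := two_pi_mul_lt_exp_sub_one hx'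
          linarith
        have h2 := (exp_pos (2 * π * x)).ne'
        field_simp, ← mul_assoc, ← hs]
    refine tsum_congr fun n => ?_
    rw [← exp_nat_mul, mul_assoc, ← exp_add]
    congr 2
    ring
  rw [setIntegral_congr_fun measurableSet_Ioi hgeom,
    ← (hasSum_integral_of_summable_integral_norm (fun n => (hterm n).1) ?_).tsum_eq]
  · simp only [(hterm _).2]
    exact hzeta.tsum_eq
  · refine hzeta.summable.congr fun n => ?_
    rw [← (hterm n).2]
    refine setIntegral_congr_fun measurableSet_Ioi fun x hx => ?_
    have hx' : 0 < x := hx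
    exact (norm_of_nonneg (mul_nonneg hx'.le (exp_pos _).le)).symm

lemma boseWeight_le_exp {x : ℝ} (hx : 0 < x) : boseWeight x ≤ exp (-π * x) := by
  have hp : 0 < π * x := by positivity
  have h0 : 0 < 2 * π * x := by positivity
  rw [boseWeight, div_le_iff₀ (h0.trans (two_pi_mul_lt_exp_sub_one hx)),
    show 2 * π * x = π * x + π * x by ring, exp_add, neg_mul]
  have h1 : exp (-(π * x)) * exp (π * x) = 1 := by rw [← exp_add]; simp
  have h2 : exp (-(π * x)) ≤ 1 := exp_le_one_iff.2 (by linarith)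
  have h3 := add_one_le_exp (π * x)
  have h4 : x ≤ π * x := by nlinarith [pi_gt_three]
  rw [mul_sub, ← mul_assoc, h1]
  linarith

lemma integrableOn_boseWeight_mul_pow (j : ℕ) :
    IntegrableOn (fun x => boseWeight x * x ^ j) (Ioi 0) := by
  have hi := integrableOn_rpow_mul_exp_neg_mul_rpow (p := 1) (s := j)
    (by linarith [Nat.cast_nonneg (α := ℝ) j]) one_pos pi_pos
  simp only [rpow_one, rpow_natCast] at hi
  have hm := measurable_boseWeight
  refine Integrable.mono' hi (by fun_prop)
    ((ae_restrict_iff' measurableSet_Ioi).2 (ae_of_all _ fun x hx => ?_))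
  have hx' : 0 < x := hx
  rw [norm_of_nonneg (mul_nonneg (boseWeight_nonneg hx) (pow_nonneg hx'.le j)), mul_comm]
  exact mul_le_mul_of_nonneg_left (boseWeight_le_exp hx) (pow_nonneg hx'.le j)

lemma exists_abs_exp_neg_mul_eval_sub_le (p : Polynomial ℝ) :
    ∃ C : ℝ, 0 ≤ C ∧ ∀ y : ℝ, 0 ≤ y → |exp (-y) * p.eval y - p.eval 0| ≤ C * y := by
  obtain ⟨C, hC, h⟩ := exists_abs_eval_mul_exp_neg_le p.divX
  refine ⟨C + |p.eval 0|, by positivity, fun y hy => ?_⟩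
  have hp : p.eval y = p.divX.eval y * y + p.eval 0 := by
    conv_lhs => rw [← p.divX_mul_X_add]
    simp [Polynomial.coeff_zero_eq_eval_zero]
  have h1 : |exp (-y) * p.divX.eval y| ≤ C :=
    (h y hy).trans (mul_le_of_le_one_right hC (exp_le_one_iff.2 (by linarith)))
  have h2 : |exp (-y) - 1| ≤ y := by
    rw [abs_sub_comm, abs_of_nonneg (sub_nonneg.2 (exp_le_one_iff.2 (by linarith)))]
    linarith [add_one_le_exp (-y)]
  calc _ = |exp (-y) * p.divX.eval y * y + p.eval 0 * (exp (-y) - 1)| := by rw [hp]; ring_nf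
    _ ≤ |exp (-y) * p.divX.eval y| * y + |p.eval 0| * |exp (-y) - 1| := by
      refine (abs_add_le _ _).trans_eq ?_
      rw [abs_mul, abs_mul (p.eval 0), abs_of_nonneg hy]
    _ ≤ C * y + |p.eval 0| * y := by gcongr
    _ = _ := by ring

/-- Replacing `e^{-y} p(y)` by `p(0)` costs `O(α)`, the second moment of the Bose–Einstein weight
being finite. -/
lemma exists_abs_gaussMoment_boseWeight_sub_le (p : Polynomial ℝ) :
    ∃ C : ℝ, ∀ α : ℝ, 0 < α →
      |gaussMoment boseWeight p α - p.eval 0 / 24| ≤ C * α := by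
  obtain ⟨C, hC, h⟩ := exists_abs_exp_neg_mul_eval_sub_le p
  refine ⟨C * ∫ x in Ioi (0 : ℝ), boseWeight x * x ^ 2, fun α hα => ?_⟩
  have hi0 : IntegrableOn boseWeight (Ioi 0) := by
    simpa using integrableOn_boseWeight_mul_pow 0
  have hi := integrableOn_gaussMoment measurable_boseWeight abs_boseWeight_le p hα
  have e : gaussMoment boseWeight p α - p.eval 0 / 24 = ∫ x in Ioi (0 : ℝ),
      (boseWeight x * (exp (-(α * x ^ 2)) * p.eval (α * x ^ 2)) - boseWeight x * p.eval 0) := by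
    rw [integral_sub hi (hi0.mul_const _), integral_mul_const, integral_boseWeight, gaussMoment]
    ring
  rw [e, ← norm_eq_abs, mul_right_comm, ← integral_const_mul]
  refine norm_integral_le_of_norm_le ((integrableOn_boseWeight_mul_pow 2).const_mul _)
    ((ae_restrict_iff' measurableSet_Ioi).2 (ae_of_all _ fun x hx => ?_))
  have hb := boseWeight_nonneg hx
  rw [← mul_sub, norm_mul, norm_of_nonneg hb, norm_eq_abs]
  calc _ ≤ boseWeight x * (C * (α * x ^ 2)) :=
        mul_le_mul_of_nonneg_left (h _ (by positivity)) hb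
    _ = _ := by ring

lemma cothKernel_gaussMoment (p : Polynomial ℝ) {α : ℝ} (hα : 0 < α) :
    gaussMoment cothKernel p α = expMoment p / (2 * α) + 2 * gaussMoment boseWeight p α := by
  have hw : ∀ x : ℝ, 0 < x → |x| ≤ 1 + x := fun x hx => by rw [abs_of_pos hx]; linarith
  rw [← gaussMoment_id p hα]
  simp only [gaussMoment]
  rw [← integral_const_mul, ← integral_add
    (integrableOn_gaussMoment (w := fun x => x) measurable_id hw p hα)
    ((integrableOn_gaussMoment measurable_boseWeight abs_boseWeight_le p hα).const_mul 2)]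
  congr 1
  funext x
  rw [cothKernel]
  ring

/-- After the reflection `x ↦ -x` the kernel is `x / (1 - e^{-2πx}) = x + x / (e^{2πx} - 1)`. -/
lemma hypIntegrand_neg (n : ℕ) (α : ℝ) {x : ℝ} (hx : 0 < x) :
    hypIntegrand (-n) α (-x) =
      (x + boseWeight x) * (exp (-(α * x ^ 2)) * (kummerPoly n).eval (α * x ^ 2)) := by
  have h1 : exp (2 * π * x) - 1 ≠ 0 := by
    have := two_pi_mul_lt_exp_sub_one hx
    have : 0 < 2 * π * x := by positivity
    linarith
  have h2 : x + boseWeight x = -x / (exp (2 * π * -x) - 1) := by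
    have h3 : exp (2 * π * -x) = (exp (2 * π * x))⁻¹ := by rw [← exp_neg]; ring_nf
    have h4 := (exp_pos (2 * π * x)).ne'
    rw [h3, boseWeight]
    generalize exp (2 * π * x) = u at *
    have h5 : u⁻¹ - 1 ≠ 0 := by
      intro h
      have hu : u⁻¹ = 1 := by linarith
      rw [inv_eq_one] at hu
      exact h1 (by rw [hu, sub_self])
    rw [eq_div_iff h5]
    field_simp
    ring
  rw [hypIntegrand, h2, neg_sq, mul_assoc 2 α, kummerF_neg_nat, neg_mul α]
  ring

lemma integrableOn_hypIntegrand (n : ℕ) {α : ℝ} (hα : 0 < α) :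
    IntegrableOn (hypIntegrand (-n) α) (Iic 0) ∧
      ∫ x in Iic (0 : ℝ), hypIntegrand (-n) α x =
        expMoment (kummerPoly n) / (2 * α) + gaussMoment boseWeight (kummerPoly n) α := by
  have hw : ∀ x : ℝ, 0 < x → |x| ≤ 1 + x := fun x hx => by rw [abs_of_pos hx]; linarith
  have hi1 := integrableOn_gaussMoment (w := fun x => x) measurable_id hw (kummerPoly n) hα
  have hi2 := integrableOn_gaussMoment measurable_boseWeight abs_boseWeight_le (kummerPoly n) hα
  have heq : EqOn (fun x => x * (exp (-(α * x ^ 2)) * (kummerPoly n).eval (α * x ^ 2)) +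
      boseWeight x * (exp (-(α * x ^ 2)) * (kummerPoly n).eval (α * x ^ 2)))
      (fun x => hypIntegrand (-n) α (-x)) (Ioi 0) := fun x hx => by
    beta_reduce
    rw [hypIntegrand_neg n α hx, add_mul]
  constructor
  · have h := (hi1.add hi2).congr_fun heq measurableSet_Ioi
    rw [integrableOn_Iic_iff_integrableOn_Iio]
    have := h.comp_neg
    simpa using this
  · have h := integral_comp_neg_Iic (0 : ℝ) (fun x => hypIntegrand (-n) α (-x))
    simp only [neg_neg, neg_zero] at h
    rw [h, ← setIntegral_congr_fun measurableSet_Ioi heq, integral_add hi1 hi2,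
      ← gaussMoment_id _ hα]
    rfl

/-- The constant term of `hypSide` is absorbed by the part of the integral with kernel `x`. -/
lemma hypSide_eq (n : ℕ) {α : ℝ} (hα : 0 < α) : hypSide (-n) α = -2 * cothMoment n α := by
  rw [hypSide, (integrableOn_hypIntegrand n hα).2, cothMoment, cothKernel_gaussMoment _ hα,
    hypConst_neg_nat, show (-1 / 4 : ℝ) = 3 / 4 - 1 by norm_num, rpow_sub_one hα.ne']
  field_simp
  ring

lemma hypSide_symm (n : ℕ) {α β : ℝ} (hα : 0 < α) (hβ : 0 < β) (h : α * β = π ^ 2) :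
    hypSide (-n) β = (-1) ^ n * hypSide (-n) α := by
  have hb : β = π ^ 2 / α := by field_simp; linarith
  rw [hypSide_eq n hα, hypSide_eq n hβ, hb, cothMoment_symm n hα]
  ring

lemma hypSide_expansion (n : ℕ) :
    HasTwoTermExpansion (fun α => hypSide (-n) α) (-hypConst (-n)) (-1 / 6) := by
  obtain ⟨C, hC⟩ := exists_abs_gaussMoment_boseWeight_sub_le (kummerPoly n)
  refine IsBigO.of_bound (4 * C) ?_
  filter_upwards [self_mem_nhdsWithin] with α (hα : 0 < α)
  have h := hC α hα
  rw [kummerPoly_eval_zero] at h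
  have e : hypSide (-n) α - (-hypConst (-n) * α ^ (-1 / 4 : ℝ) + -1 / 6 * α ^ (3 / 4 : ℝ)) =
      -4 * α ^ (3 / 4 : ℝ) * (gaussMoment boseWeight (kummerPoly n) α - 1 / 24) := by
    rw [hypSide_eq n hα, cothMoment, cothKernel_gaussMoment _ hα, hypConst_neg_nat,
      show (-1 / 4 : ℝ) = 3 / 4 - 1 by norm_num, rpow_sub_one hα.ne']
    field_simp
    ring
  have hp := rpow_pos_of_pos hα (3 / 4)
  rw [e, show (7 / 4 : ℝ) = 3 / 4 + 1 by norm_num, rpow_add_one hα.ne', norm_mul, norm_mul,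
    norm_eq_abs, norm_eq_abs, norm_eq_abs, norm_eq_abs, abs_of_pos hp, abs_of_pos (mul_pos hp hα),
    show |(-4 : ℝ)| = 4 by norm_num]
  calc _ ≤ 4 * α ^ (3 / 4 : ℝ) * (C * α) := by gcongr
    _ = _ := by ring

lemma abs_one_add_rpow_quarter_sub_le {u : ℝ} (hu : 0 ≤ u) :
    |(1 + u) ^ (1 / 4 : ℝ) - (1 + u / 4)| ≤ u ^ 2 := by
  -- with `1 + u = (1 + s)^4` both bounds are polynomial inequalities in `s ≥ 0`
  obtain ⟨s, hs, rfl⟩ : ∃ s : ℝ, 0 ≤ s ∧ u = (1 + s) ^ 4 - 1 := by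
    refine ⟨(1 + u) ^ (1 / 4 : ℝ) - 1, ?_, ?_⟩
    · exact sub_nonneg.2 (one_le_rpow (by linarith) (by norm_num))
    · rw [add_sub_cancel, ← rpow_natCast, ← rpow_mul (by linarith)]
      norm_num
  have e : (1 + ((1 + s) ^ 4 - 1)) ^ (1 / 4 : ℝ) = 1 + s := by
    rw [add_sub_cancel, ← rpow_natCast, ← rpow_mul (by linarith)]
    norm_num
  have h2 : 0 ≤ s ^ 2 := by positivity
  have h3 : 0 ≤ s ^ 3 := by positivity
  have h4 : 0 ≤ s ^ 4 := by positivity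
  rw [e, abs_le]
  constructor
  · have : ((1 + s) ^ 4 - 1) ^ 2 = 16 * s ^ 2 + 48 * s ^ 3 + 68 * s ^ 4 + 56 * s ^ 5 +
        28 * s ^ 6 + 8 * s ^ 7 + s ^ 8 := by ring
    rw [this]
    have h5 : 0 ≤ 56 * s ^ 5 + 28 * s ^ 6 + 8 * s ^ 7 + s ^ 8 := by positivity
    nlinarith
  · have : 1 + s - (1 + ((1 + s) ^ 4 - 1) / 4) = -(6 * s ^ 2 + 4 * s ^ 3 + s ^ 4) / 4 := by ring
    rw [this]
    have := sq_nonneg ((1 + s) ^ 4 - 1)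
    linarith

/-- With `u = 2t/(3C) + t²/π²` the base is `t⁻¹ (1 + u)`, and `C u / 4 = t/6 + O(t²)`. -/
lemma hypApprox_expansion {a : ℝ} (ha : 0 < hypConst a) :
    HasTwoTermExpansion (fun α => hypApprox a α (π ^ 2 / α)) (-hypConst a) (-1 / 6) := by
  set C := hypConst a with hCdef
  refine IsBigO.of_bound (C * (1 / (4 * π ^ 2) + (2 / (3 * C) + 1 / π ^ 2) ^ 2)) ?_
  filter_upwards [self_mem_nhdsWithin, mem_nhdsWithin_of_mem_nhds (eventually_lt_nhds one_pos)]
    with t (ht : 0 < t) (ht1 : t < 1)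
  have hp := pi_pos
  set u := 2 / (3 * C) * t + t ^ 2 / π ^ 2 with hu
  have hu0 : 0 ≤ u := by positivity
  have hbase : 1 / t + 1 / (π ^ 2 / t) + 2 / (3 * C) = t⁻¹ * (1 + u) := by
    rw [hu]; field_simp; ring
  have hq : (t⁻¹) ^ (1 / 4 : ℝ) = t ^ (-1 / 4 : ℝ) := by
    rw [inv_rpow ht.le, ← rpow_neg ht.le]; norm_num
  have h34 : t ^ (3 / 4 : ℝ) = t ^ (-1 / 4 : ℝ) * t := by
    rw [← rpow_add_one ht.ne']; norm_num
  have h74 : t ^ (7 / 4 : ℝ) = t ^ (-1 / 4 : ℝ) * t ^ 2 := by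
    rw [← rpow_natCast, ← rpow_add ht]; norm_num
  have hpos := rpow_pos_of_pos ht (-1 / 4)
  have e : hypApprox a t (π ^ 2 / t) - (-C * t ^ (-1 / 4 : ℝ) + -1 / 6 * t ^ (3 / 4 : ℝ)) =
      -(C * t ^ (-1 / 4 : ℝ)) *
        (((1 + u) ^ (1 / 4 : ℝ) - (1 + u / 4)) + t ^ 2 / (4 * π ^ 2)) := by
    rw [hypApprox, ← hCdef, hbase, mul_rpow (by positivity) (by positivity), hq, h34]
    have : u / 4 = t / (6 * C) + t ^ 2 / (4 * π ^ 2) := by rw [hu]; field_simp; ring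
    rw [this]
    field_simp
    ring
  have hule : u ≤ (2 / (3 * C) + 1 / π ^ 2) * t := by
    rw [hu, add_mul]
    gcongr
    rw [div_mul_eq_mul_div, one_mul]
    gcongr
    nlinarith
  have hbd : |((1 + u) ^ (1 / 4 : ℝ) - (1 + u / 4)) + t ^ 2 / (4 * π ^ 2)| ≤
      ((2 / (3 * C) + 1 / π ^ 2) * t) ^ 2 + t ^ 2 / (4 * π ^ 2) := by
    refine (abs_add_le _ _).trans (add_le_add ((abs_one_add_rpow_quarter_sub_le hu0).trans ?_) ?_)
    · gcongr
    · rw [abs_of_nonneg (by positivity)]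
  rw [e, h74, norm_mul, norm_neg, norm_eq_abs, norm_eq_abs, norm_eq_abs,
    abs_of_pos (mul_pos ha hpos), abs_of_pos (mul_pos hpos (pow_pos ht 2))]
  calc _ ≤ C * t ^ (-1 / 4 : ℝ) *
        (((2 / (3 * C) + 1 / π ^ 2) * t) ^ 2 + t ^ 2 / (4 * π ^ 2)) := by gcongr
    _ = _ := by field_simp; ring

end

theorem theorem5p1 (k : ℕ) :
    -- all the integrals converge
    (∀ α : ℝ, 0 < α →
      IntegrableOn (hypIntegrand (-2 * k) α) (Iic 0) ∧
      IntegrableOn (hypIntegrand (-2 * k - 1) α) (Iic 0)) ∧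
    -- (i)
    (∀ α β : ℝ, 0 < α → 0 < β → α * β = π ^ 2 →
      hypSide (-2 * k) α = hypSide (-2 * k) β) ∧
    -- (ii): the constant is positive, so the approximating function is well defined; it and the
    -- side of (i) have the same first two terms, for small `α` and for large `α` (small `β`)
    (0 < hypConst (-2 * k) ∧
      HasTwoTermExpansion (fun α => hypSide (-2 * k) α) (-hypConst (-2 * k)) (-1 / 6) ∧
      HasTwoTermExpansion (fun α => hypApprox (-2 * k) α (π ^ 2 / α))
        (-hypConst (-2 * k)) (-1 / 6) ∧
      HasTwoTermExpansion (fun β => hypSide (-2 * k) (π ^ 2 / β)) (-hypConst (-2 * k)) (-1 / 6) ∧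
      HasTwoTermExpansion (fun β => hypApprox (-2 * k) (π ^ 2 / β) β)
        (-hypConst (-2 * k)) (-1 / 6)) ∧
    -- (iii)
    (∀ α β : ℝ, 0 < α → 0 < β → α * β = π ^ 2 →
      -hypSide (-2 * k - 1) α = hypSide (-2 * k - 1) β) ∧
    -- the exact evaluation for `α = β = π`
    ∫ x in Iic (0 : ℝ), hypIntegrand (-2 * k - 1) π x
      = 1 / (4 * π) * hypConst (-2 * k - 1) := by
  have hev : (-2 * k : ℝ) = -((2 * k : ℕ) : ℝ) := by push_cast; ring
  have hod : (-2 * k - 1 : ℝ) = -((2 * k + 1 : ℕ) : ℝ) := by push_cast; ring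
  rw [hod, hev]
  have hC : 0 < hypConst (-((2 * k : ℕ) : ℝ)) := by
    have := expMoment_kummerPoly_sign (2 * k)
    rwa [(even_two_mul k).neg_one_pow, one_mul, ← hypConst_neg_nat] at this
  have hsymm : ∀ α β : ℝ, 0 < α → 0 < β → α * β = π ^ 2 →
      hypSide (-((2 * k : ℕ) : ℝ)) α = hypSide (-((2 * k : ℕ) : ℝ)) β := by
    intro α β hα hβ h
    rw [hypSide_symm _ hα hβ h, (even_two_mul k).neg_one_pow, one_mul]
  have hanti : ∀ α β : ℝ, 0 < α → 0 < β → α * β = π ^ 2 →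
      -hypSide (-((2 * k + 1 : ℕ) : ℝ)) α = hypSide (-((2 * k + 1 : ℕ) : ℝ)) β := by
    intro α β hα hβ h
    rw [hypSide_symm _ hα hβ h, (odd_two_mul_add_one k).neg_one_pow, neg_one_mul]
  refine ⟨fun α hα => ⟨(integrableOn_hypIntegrand _ hα).1, (integrableOn_hypIntegrand _ hα).1⟩,
    hsymm, ⟨hC, hypSide_expansion _, hypApprox_expansion hC, ?_, ?_⟩, hanti, ?_⟩
  · refine (hypSide_expansion (2 * k)).congr' ?_ EventuallyEq.rfl
    filter_upwards [self_mem_nhdsWithin] with β (hβ : 0 < β)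
    rw [hsymm β (π ^ 2 / β) hβ (by positivity) (by field_simp)]
  · refine (hypApprox_expansion hC).congr_left fun β => ?_
    simp only [hypApprox]
    rw [add_comm (1 / β)]
  · -- at the fixed point `α = β = π` of the inversion the antisymmetric function vanishes
    have hp := pi_pos
    have h0 := hanti π π hp hp (sq π).symm
    have h1 : hypSide (-((2 * k + 1 : ℕ) : ℝ)) π = 0 := by linarith
    rw [hypSide, show (-1 / 4 : ℝ) = 3 / 4 - 1 by norm_num, rpow_sub_one hp.ne'] at h1
    have h2 := rpow_pos_of_pos hp (3 / 4)
    generalize (∫ x in Iic (0 : ℝ), hypIntegrand (-((2 * k + 1 : ℕ) : ℝ)) π x) = J at h1 ⊢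
    have h3 : π ^ (3 / 4 : ℝ) *
        (hypConst (-((2 * k + 1 : ℕ) : ℝ)) - 4 * π * J) = 0 := by
      field_simp at h1
      linarith
    have h4 := (mul_eq_zero.1 h3).resolve_left h2.ne'
    field_simp
    linarith
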